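/- For $n,d\ge 1$ let $\hat U(k)=\bigotimes_{l=1}^{n}\hat U_l(k)$, $k\in\{0,\dots,d-1\}$, with arbitrary $\hat U_l(k)\in \mathrm{SU}(2)$, be an $n$-word product unitary function. Consider an index register of $\lceil\log_2 d\rceil$ qubits, in which $|k\rangle$ denotes the computational basis state given by the binary digits of $k$, and a word register of $n$ qubits, and let $$\mathrm{select}(\hat U)=\sum_{k=0}^{d-1}|k\rangle\langle k|\otimes\hat U(k),\qquad\text{so that}\qquad \mathrm{select}(\hat U)\,|k\rangle|z\rangle=|k\rangle\,\hat U(k)|z\rangle .$$ Then there is a universal constant $c$ such that for all $n,d\ge 1$ with $nd\ge 2$ and every such $\hat U$ there is a quantum circuit that consists of single- and two-qubit unitary gates, uses $a\le c\,nd$ ancillary qubits, has depth at most $c\log(nd)$ (the depth is the number of layers, where the gates in a layer act on pairwise disjoint sets of qubits), and realizes $\mathrm{select}(\hat U)$: it maps $|\psi\rangle\otimes|0\rangle^{\otimes a}$ to $(\mathrm{select}(\hat U)|\psi\rangle)\otimes|0\rangle^{\otimes a}$ for every state $|\psi\rangle$ in the span of the states $|k\rangle|z\rangle$ with $0\le k<d$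 and $z\in\{0,1\}^n$. That is, $\mathrm{select}(\hat U)$ is realized with depth $O(\log(nd))$ and $O(nd)$ ancillary qubits. -/

import Mathlib

open scoped Kronecker

noncomputable section

namespace PUM

/-! ### Quantum circuits of single- and two-qubit gates -/

/-- (Unnormalised) pure states of a system of qubits labelled by `ι`: amplitudes in the
computational basis, whose elements are the bit assignments `ι → Fin 2`. -/
abbrev State (ι : Type) : Type := (ι → Fin 2) → ℂ

/-- A gate: an arbitrary unitary on one qubit `a`, or on two distinct qubits `a`, `b`. -/
inductive Gate (ι : Type) : Type
  | one (a : ι) (u : Matrix.unitaryGroup (Fin 2) ℂ) : Gate ι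
  | two (a b : ι) (hab : a ≠ b) (u : Matrix.unitaryGroup (Fin 2 × Fin 2) ℂ) : Gate ι

/-- The set of qubits on which a gate acts. -/
def Gate.qubits {ι : Type} [DecidableEq ι] : Gate ι → Finset ι
  | .one a _ => {a}
  | .two a b _ _ => {a, b}

/-- The action of a gate on states: its matrix acts on the qubits of the gate, and the
identity acts on all other qubits. -/
def Gate.op {ι : Type} [DecidableEq ι] : Gate ι → (State ι →ₗ[ℂ] State ι)
  | .one a u =>
    { toFun := fun ψ x =>
        ∑ s : Fin 2, (u : Matrix (Fin 2) (Fin 2) ℂ) (x a) s * ψ (Function.update x a s)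
      map_add' := fun ψ φ => by
        funext x
        simp only [Pi.add_apply, mul_add, Finset.sum_add_distrib]
      map_smul' := fun c ψ => by
        funext x
        simp only [Pi.smul_apply, smul_eq_mul, RingHom.id_apply, Finset.mul_sum]
        exact Finset.sum_congr rfl fun s _ => by ring }
  | .two a b _ u =>
    { toFun := fun ψ x =>
        ∑ s : Fin 2 × Fin 2, (u : Matrix (Fin 2 × Fin 2) (Fin 2 × Fin 2) ℂ) (x a, x b) s *
          ψ (Function.update (Function.update x a s.1) b s.2)
      map_add' := fun ψ φ => by
        funext x
        simp only [Pi.add_apply, mul_add, Finset.sum_add_distrib]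
      map_smul' := fun c ψ => by
        funext x
        simp only [Pi.smul_apply, smul_eq_mul, RingHom.id_apply, Finset.mul_sum]
        exact Finset.sum_congr rfl fun s _ => by ring }

/-- A layer: finitely many gates acting on pairwise disjoint sets of qubits, so that they
can be performed simultaneously. -/
structure Layer (ι : Type) [DecidableEq ι] : Type where
  gates : List (Gate ι)
  disjoint : gates.Pairwise fun g h => Disjoint g.qubits h.qubits

/-- The action of a layer (the gates commute, so their order is immaterial). -/
def Layer.run {ι : Type} [DecidableEq ι] (L : Layer ι) (ψ : State ι) : State ι :=
  L.gates.foldl (fun φ g => g.op φ) ψ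

/-- A circuit: a finite sequence of layers, the head of the list being performed first. -/
abbrev Circuit (ι : Type) [DecidableEq ι] : Type := List (Layer ι)

/-- The circuit depth is the number of layers. -/
def Circuit.depth {ι : Type} [DecidableEq ι] (C : Circuit ι) : ℕ := C.length

/-- The action of a circuit on states. -/
def Circuit.run {ι : Type} [DecidableEq ι] (C : Circuit ι) (ψ : State ι) : State ι :=
  C.foldl (fun φ L => L.run φ) ψ

/-! ### Product unitary functions and their selector -/

/-- An `n`-word product unitary function on `{0, …, d - 1}`, given by its factors
`U l k ∈ SU(2)`. -/
abbrev ProductUnitaryFunction (n d : ℕ) : Type :=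
  Fin n → Fin d → Matrix.specialUnitaryGroup (Fin 2) ℂ

/-- The unitary `U(k) = ⨂ₗ U_l(k)` on the `n`-qubit word register. -/
def ProductUnitaryFunction.unitary {n d : ℕ} (U : ProductUnitaryFunction n d) (k : Fin d) :
    Matrix (Fin n → Fin 2) (Fin n → Fin 2) ℂ :=
  Matrix.of fun x y => ∏ l, (U l k : Matrix (Fin 2) (Fin 2) ℂ) (x l) (y l)

/-- The computational basis label of `|k⟩` in the index register of `⌈log₂ d⌉` qubits:
qubit `i` carries the binary digit of `k` of weight `2 ^ i`. -/
def indexBits {d : ℕ} (k : Fin d) : Fin (Nat.clog 2 d) → Fin 2 :=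
  fun i => if (k : ℕ).testBit i then 1 else 0

/-- `select(U) = ∑_{k < d} |k⟩⟨k| ⊗ U(k)`, on the index register and the word register. -/
def select {n d : ℕ} (U : ProductUnitaryFunction n d) :
    Matrix ((Fin (Nat.clog 2 d) → Fin 2) × (Fin n → Fin 2))
      ((Fin (Nat.clog 2 d) → Fin 2) × (Fin n → Fin 2)) ℂ :=
  ∑ k : Fin d, Matrix.single (indexBits k) (indexBits k) (1 : ℂ) ⊗ₖ U.unitary k

/-! ### Realization with ancillary qubits -/

/-- The qubits of the circuit: `m` index qubits, `n` word qubits and `a` ancillary qubits. -/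
abbrev Wire (m n a : ℕ) : Type := Fin m ⊕ Fin n ⊕ Fin a

/-- `ψ ⊗ |0⟩^{⊗ a}`, for a state `ψ` of the index and word registers. -/
def withAncillas {m n : ℕ} (a : ℕ) (ψ : (Fin m → Fin 2) × (Fin n → Fin 2) → ℂ) :
    State (Wire m n a) :=
  fun x => if ∀ j : Fin a, x (.inr (.inr j)) = 0
    then ψ (fun i => x (.inl i), fun l => x (.inr (.inl l))) else 0

/-- The circuit `C` realizes `select(U)` with `a` ancillary qubits: for every input state `ψ` in
the span of the states `|k⟩|z⟩` with `k < d`, it maps `ψ ⊗ |0⟩^{⊗ a}` to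
`select(U) ψ ⊗ |0⟩^{⊗ a}`. -/
def RealizesSelect {n d a : ℕ} (U : ProductUnitaryFunction n d)
    (C : Circuit (Wire (Nat.clog 2 d) n a)) : Prop :=
  ∀ ψ : (Fin (Nat.clog 2 d) → Fin 2) × (Fin n → Fin 2) → ℂ,
    (∀ x z, ψ (x, z) ≠ 0 → ∃ k : Fin d, x = indexBits k) →
    C.run (withAncillas a ψ) = withAncillas a ((select U).mulVec ψ)

end PUM

end

noncomputable section

namespace PUM

open Matrix

/-! ### Reversing circuits -/

/-! Instead of bringing the index `k` to the gates one after another, the word is carried to a place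
that depends on `k`. Each word qubit gets `2 ^ m` data positions, `m = Nat.clog 2 d`, and its state
is routed through a binary tree to position `k`; a flag, initially 1, takes the same route in a
parallel lane. All `n * d` gates `U l j` then fit into one layer: `U l j` sits at position `j`,
controlled by the flag there, so that only `j = k` acts and blank positions stay `|0⟩`
(`implements_apply`). Reversing the routing returns the word and clears the ancillas.

Logarithmic depth needs every routing decision to have its own control qubit. Copies of the index
bits are made by repeated doubling, across lanes in about `log n` layers (`implementsBasis_fanout`)
and inside each lane by one doubling per tree level (`implementsBasis_copy_level`). A level moves
qubits into blank positions, which takes four layers of two-qubit gates (`implementsBasis_move`).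

On inputs `|k⟩|z⟩` the state remains a product, and each gate has a basis ket on its control, so it
suffices to track single-qubit factors (`Implements`). Only the application of `U k` creates
superpositions. These are expanded in routed basis states, and linearity of the reversed routing
finishes the argument (`exists_circuit_basis`). -/

theorem Gate.exists_inverse {ι : Type} [DecidableEq ι] (g : Gate ι) :
    ∃ g' : Gate ι, g'.qubits = g.qubits ∧ ∀ ψ, g'.op (g.op ψ) = ψ := by
  cases g with
  | one a u =>
    refine ⟨.one a u⁻¹, rfl, fun ψ => ?_⟩
    funext x
    have h : ((u⁻¹ : Matrix.unitaryGroup (Fin 2) ℂ) : Matrix (Fin 2) (Fin 2) ℂ) * u = 1 := by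
      rw [← Matrix.UnitaryGroup.mul_val, inv_mul_cancel, Matrix.UnitaryGroup.one_val]
    simp only [Gate.op, LinearMap.coe_mk, AddHom.coe_mk, Function.update_self,
      Function.update_idem, Finset.mul_sum]
    rw [Finset.sum_comm]
    simp only [← mul_assoc, ← Finset.sum_mul]
    have h' : ∀ s, ∑ i, ((u⁻¹ : Matrix.unitaryGroup (Fin 2) ℂ) : Matrix (Fin 2) (Fin 2) ℂ) (x a) i
        * (u : Matrix (Fin 2) (Fin 2) ℂ) i s = if x a = s then 1 else 0 := fun s => by
      rw [← Matrix.mul_apply, h, Matrix.one_apply]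
    simp only [h', ite_mul, one_mul, zero_mul, Finset.sum_ite_eq, Finset.mem_univ, if_true,
      Function.update_eq_self]
  | two a b hab u =>
    refine ⟨.two a b hab u⁻¹, rfl, fun ψ => ?_⟩
    funext x
    have h : ((u⁻¹ : Matrix.unitaryGroup (Fin 2 × Fin 2) ℂ) :
        Matrix (Fin 2 × Fin 2) (Fin 2 × Fin 2) ℂ) * u = 1 := by
      rw [← Matrix.UnitaryGroup.mul_val, inv_mul_cancel, Matrix.UnitaryGroup.one_val]
    have hupd : ∀ s t : Fin 2 × Fin 2, Function.update (Function.update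
        (Function.update (Function.update x a s.1) b s.2) a t.1) b t.2 =
        Function.update (Function.update x a t.1) b t.2 := fun s t => by
      rw [Function.update_comm hab.symm, Function.update_idem, Function.update_idem]
    simp only [Gate.op, LinearMap.coe_mk, AddHom.coe_mk, Function.update_self,
      Function.update_of_ne hab, hupd, Finset.mul_sum]
    rw [Finset.sum_comm]
    simp only [← mul_assoc, ← Finset.sum_mul, Prod.mk.eta]
    have h' : ∀ s, ∑ i, ((u⁻¹ : Matrix.unitaryGroup (Fin 2 × Fin 2) ℂ) :
        Matrix (Fin 2 × Fin 2) (Fin 2 × Fin 2) ℂ) (x a, x b) i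
        * (u : Matrix (Fin 2 × Fin 2) (Fin 2 × Fin 2) ℂ) i s =
        if (x a, x b) = s then 1 else 0 := fun s => by
      rw [← Matrix.mul_apply, h, Matrix.one_apply]
    simp only [h', ite_mul, one_mul, zero_mul, Finset.sum_ite_eq, Finset.mem_univ, if_true,
      Function.update_eq_self]

theorem Layer.exists_inverse {ι : Type} [DecidableEq ι] (L : Layer ι) :
    ∃ L' : Layer ι, ∀ ψ, L'.run (L.run ψ) = ψ := by
  choose inv hq hinv using Gate.exists_inverse (ι := ι)
  refine ⟨⟨(L.gates.map inv).reverse, ?_⟩, fun ψ => ?_⟩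
  · rw [List.pairwise_reverse, List.pairwise_map]
    refine L.disjoint.imp fun {g h} hgh => ?_
    rw [hq, hq]
    exact hgh.symm
  · simp only [Layer.run, List.foldl_reverse]
    generalize L.gates = l
    induction l generalizing ψ with
    | nil => rfl
    | cons g l ih => simp only [List.foldl_cons, List.map_cons, List.foldr_cons, ih, hinv]

theorem Circuit.exists_inverse {ι : Type} [DecidableEq ι] (C : Circuit ι) :
    ∃ C' : Circuit ι, C'.depth = C.depth ∧ ∀ ψ, C'.run (C.run ψ) = ψ := by
  choose inv hinv using Layer.exists_inverse (ι := ι)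
  refine ⟨(C.map inv).reverse, by simp [Circuit.depth], fun ψ => ?_⟩
  simp only [Circuit.run, List.foldl_reverse]
  induction C generalizing ψ with
  | nil => rfl
  | cons g l ih => simp only [List.foldl_cons, List.map_cons, List.foldr_cons, ih, hinv]

theorem Circuit.run_append {ι : Type} [DecidableEq ι] (C D : Circuit ι) (ψ : State ι) :
    Circuit.run (C ++ D) ψ = Circuit.run D (Circuit.run C ψ) := by
  simp [Circuit.run]

/-- The action of a circuit, as a linear map. -/
theorem Circuit.exists_linearMap {ι : Type} [DecidableEq ι] (C : Circuit ι) :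
    ∃ A : State ι →ₗ[ℂ] State ι, ∀ ψ, C.run ψ = A ψ := by
  have hL : ∀ L : Layer ι, ∃ A : State ι →ₗ[ℂ] State ι, ∀ ψ, L.run ψ = A ψ := by
    intro L
    simp only [Layer.run]
    generalize L.gates = l
    induction l with
    | nil => exact ⟨LinearMap.id, fun ψ => rfl⟩
    | cons g l ih =>
      obtain ⟨A, hA⟩ := ih
      exact ⟨A ∘ₗ g.op, fun ψ => by simp [hA]⟩
  induction C with
  | nil => exact ⟨LinearMap.id, fun ψ => rfl⟩
  | cons L C ih =>
    obtain ⟨A, hA⟩ := ih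
    obtain ⟨B, hB⟩ := hL L
    exact ⟨A ∘ₗ B, fun ψ => by
      rw [LinearMap.comp_apply, ← hB, ← hA]; rfl⟩

/-! ### Multiplexed gates on product states -/

/-- The product state with factor `v q` on the qubit `E q`. -/
def productState {Q ι : Type} [Fintype Q] (E : Q ≃ ι) (v : Q → Fin 2 → ℂ) : State ι :=
  fun x => ∏ q, v q (x (E q))

/-- The computational basis vectors of a qubit. -/
def ket (b : Fin 2) : Fin 2 → ℂ := Pi.single b 1

/-- The two-qubit gate which applies `u i` to the second qubit if the first one is `|i⟩`. -/
def mux (u : Fin 2 → unitaryGroup (Fin 2) ℂ) : unitaryGroup (Fin 2 × Fin 2) ℂ :=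
  ⟨Matrix.of fun i j => if i.1 = j.1 then (u i.1 : Matrix (Fin 2) (Fin 2) ℂ) i.2 j.2 else 0, by
    rw [mem_unitaryGroup_iff]
    ext ⟨i, i'⟩ ⟨j, j'⟩
    have h := congrFun (congrFun (mem_unitaryGroup_iff.1 (u i).2) i') j'
    rw [Matrix.mul_apply] at h
    simp only [Matrix.mul_apply, Fintype.sum_prod_type, Matrix.of_apply, star_apply]
    by_cases hij : i = j
    · subst hij
      simp only [Matrix.one_apply, Prod.mk.injEq, true_and, star_apply] at h ⊢
      rw [← h, Finset.sum_eq_single i]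
      · simp
      · intro b _ hb
        simp [hb.symm]
      · simp
    · rw [Matrix.one_apply_ne (by simp [hij])]
      refine Finset.sum_eq_zero fun b _ => Finset.sum_eq_zero fun c _ => ?_
      by_cases hib : i = b
      · subst hib
        simp [Ne.symm hij]
      · simp [hib]⟩

/-- A basis ket on the control leaves one surviving branch, so no entanglement arises. -/
theorem mux_op_productState {Q ι : Type} [Fintype Q] [DecidableEq Q] [DecidableEq ι] (E : Q ≃ ι)
    (u : Fin 2 → unitaryGroup (Fin 2) ℂ) {c t : Q} (h : E c ≠ E t) (v : Q → Fin 2 → ℂ) {b : Fin 2}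
    (hc : v c = ket b) :
    (Gate.two (E c) (E t) h (mux u)).op (productState E v) =
      productState E (Function.update v t ((u b : Matrix (Fin 2) (Fin 2) ℂ) *ᵥ v t)) := by
  have hct : c ≠ t := fun hh => h (congrArg E hh)
  funext x
  simp only [Gate.op, LinearMap.coe_mk, AddHom.coe_mk, productState, mux, Matrix.of_apply]
  have hsplit : ∀ f : Q → ℂ, ∏ q, f q = f c * (f t * ∏ q ∈ (Finset.univ.erase c).erase t, f q) := by
    intro f
    rw [Finset.mul_prod_erase _ _ (by simp [hct.symm]), Finset.mul_prod_erase _ _ (by simp)]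
  simp only [hsplit]
  have hrest : ∀ s : Fin 2 × Fin 2, ∏ q ∈ (Finset.univ.erase c).erase t,
      v q (Function.update (Function.update x (E c) s.1) (E t) s.2 (E q)) =
      ∏ q ∈ (Finset.univ.erase c).erase t, v q (x (E q)) := fun s =>
    Finset.prod_congr rfl fun q hq => by
      simp only [Finset.mem_erase, Finset.mem_univ, and_true] at hq
      rw [Function.update_of_ne (by simpa using hq.1), Function.update_of_ne (by simpa using hq.2)]
  have hrest' : ∏ q ∈ (Finset.univ.erase c).erase t, Function.update v t
      ((u b : Matrix (Fin 2) (Fin 2) ℂ) *ᵥ v t) q (x (E q)) =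
      ∏ q ∈ (Finset.univ.erase c).erase t, v q (x (E q)) :=
    Finset.prod_congr rfl fun q hq => by
      simp only [Finset.mem_erase, Finset.mem_univ, and_true] at hq
      rw [Function.update_of_ne hq.1]
  simp only [hrest, hrest', Function.update_self, Function.update_of_ne h,
    Function.update_of_ne hct, hc, ket, Matrix.mulVec, dotProduct, Fintype.sum_prod_type]
  generalize ∏ q ∈ (Finset.univ.erase c).erase t, v q (x (E q)) = r
  rw [Finset.sum_eq_single (x (E c))]
  · by_cases hx : x (E c) = b
    · subst hx
      simp only [if_true, Pi.single_eq_same, one_mul, Finset.sum_mul]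
      exact Finset.sum_congr rfl fun s _ => by ring
    · simp [hx]
  · intro s _ hs
    simp [hs.symm]
  · simp

/-- On every member of a family, a circuit of depth at most `N` maps the product state `v i`
to the product state `v' i`. -/
def Implements {Q ι I : Type} [Fintype Q] [DecidableEq ι] (E : Q ≃ ι) (N : ℕ)
    (v v' : I → Q → Fin 2 → ℂ) : Prop :=
  ∃ C : Circuit ι, C.depth ≤ N ∧ ∀ i, C.run (productState E (v i)) = productState E (v' i)

section

variable {Q ι I : Type} [Fintype Q] [DecidableEq ι] {E : Q ≃ ι}

theorem Implements.trans {N N' : ℕ} {v v' v'' : I → Q → Fin 2 → ℂ} (h : Implements E N v v')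
    (h' : Implements E N' v' v'') : Implements E (N + N') v v'' := by
  obtain ⟨C, hC, h⟩ := h
  obtain ⟨C', hC', h'⟩ := h'
  refine ⟨C ++ C', ?_, fun i => by rw [Circuit.run_append, h, h']⟩
  simp only [Circuit.depth, List.length_append] at *
  omega

/-- Injectivity of `Sum.elim c t` makes the qubit pairs disjoint, so all gates form one layer; no
gate disturbs the control or target of another. -/
theorem implements_mux [DecidableEq Q] {κ : Type} [Fintype κ] (c t : κ → Q)
    (hinj : Function.Injective (Sum.elim c t))
    (u : κ → Fin 2 → unitaryGroup (Fin 2) ℂ) (v v' : I → Q → Fin 2 → ℂ) (b : I → κ → Fin 2)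
    (hc : ∀ i j, v i (c j) = ket (b i j))
    (ht : ∀ i j, v' i (t j) = (u j (b i j) : Matrix (Fin 2) (Fin 2) ℂ) *ᵥ v i (t j))
    (h0 : ∀ i q, (∀ j, q ≠ t j) → v' i q = v i q) : Implements E 1 v v' := by
  classical
  have hct : ∀ i j, c i ≠ t j := fun i j h => by
    have := @hinj (.inl i) (.inr j) h
    simp at this
  have hci : Function.Injective c := fun i j h => by
    have := @hinj (.inl i) (.inl j) h
    simpa using this
  have hti : Function.Injective t := fun i j h => by
    have := @hinj (.inr i) (.inr j) h
    simpa using this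
  let gate : κ → Gate ι := fun j =>
    .two (E (c j)) (E (t j)) (fun h => hct j j (E.injective h)) (mux (u j))
  refine ⟨[⟨(Finset.univ.toList (α := κ)).map gate, ?_⟩], le_rfl, fun i => ?_⟩
  · rw [List.pairwise_map]
    refine (Finset.nodup_toList _).imp fun {j k} hjk => ?_
    simp only [gate, Gate.qubits]
    simp [hci.eq_iff, hti.eq_iff, hct, (hct _ _).symm]
    grind
  · change Layer.run _ _ = _
    simp only [Layer.run]
    -- Induction over the gates still to be applied, with `w` the current factors; the controls of
    -- all gates are kept as kets throughout.
    have key : ∀ (l : List κ) (w w' : Q → Fin 2 → ℂ), l.Nodup →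
        (∀ j, w (c j) = ket (b i j)) →
        (∀ j ∈ l, w' (t j) = (u j (b i j) : Matrix (Fin 2) (Fin 2) ℂ) *ᵥ w (t j)) →
        (∀ q, (∀ j ∈ l, q ≠ t j) → w' q = w q) →
        (l.map gate).foldl (fun φ g => g.op φ) (productState E w) = productState E w' := by
      intro l
      induction l with
      | nil =>
        intro w w' _ _ _ h
        rw [show w' = w from funext fun q => h q (by simp)]
        rfl
      | cons j l ih =>
        intro w w' hl hw h1 h2
        rw [List.nodup_cons] at hl
        rw [List.map_cons, List.foldl_cons]
        simp only [gate]
        rw [mux_op_productState E (u j) _ w (hw j)]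
        refine ih _ _ hl.2 (fun k => ?_) (fun k hk => ?_) (fun q hq => ?_)
        · rw [Function.update_of_ne (hct k j), hw]
        · rw [Function.update_of_ne, h1 k (by simp [hk])]
          rintro hh
          rw [hti hh] at hk
          exact hl.1 hk
        · by_cases hqj : q = t j
          · subst hqj
            rw [Function.update_self, h1 j (by simp)]
          · rw [Function.update_of_ne hqj]
            exact h2 q fun k hk => by
              rcases List.mem_cons.1 hk with rfl | hk
              · exact hqj
              · exact hq k hk
    exact key _ _ _ (Finset.nodup_toList _) (hc i) (fun j _ => ht i j)
      (fun q hq => h0 i q fun j => hq j (by simp))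

end

/-! ### Controlled gates on basis states -/

/-- The Pauli matrix `X`. -/
def pauliX : unitaryGroup (Fin 2) ℂ :=
  ⟨!![0, 1; 1, 0], by
    rw [mem_unitaryGroup_iff]
    ext i j
    fin_cases i <;> fin_cases j <;> simp [Matrix.mul_apply, star_apply]⟩

/-- The Pauli matrix `Z`. -/
def pauliZ : unitaryGroup (Fin 2) ℂ :=
  ⟨!![1, 0; 0, -1], by
    rw [mem_unitaryGroup_iff]
    ext i j
    fin_cases i <;> fin_cases j <;> simp [Matrix.mul_apply, star_apply]⟩

/-- The Hadamard matrix, multiplied by a phase to have rational entries. -/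
def phasedHadamard : unitaryGroup (Fin 2) ℂ :=
  ⟨!![⟨1 / 2, 1 / 2⟩, ⟨1 / 2, 1 / 2⟩; ⟨1 / 2, 1 / 2⟩, ⟨-1 / 2, -1 / 2⟩], by
    rw [mem_unitaryGroup_iff]
    ext i j
    fin_cases i <;> fin_cases j <;>
      simp [Matrix.mul_apply, star_apply, Complex.ext_iff] <;> norm_num⟩

theorem pauliX_mulVec_ket (a : Fin 2) :
    (pauliX : Matrix (Fin 2) (Fin 2) ℂ) *ᵥ ket a = ket (1 + a) := by
  ext i
  fin_cases a <;> fin_cases i <;> simp [pauliX, ket, Matrix.mulVec, dotProduct]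

/-- `|z⟩` controls whether the qubit `|0⟩` is rotated so that a phase controlled by `|b⟩`
becomes a flip. -/
theorem phasedHadamard_conj (b z : Fin 2) :
    ((![1, phasedHadamard⁻¹] z : unitaryGroup (Fin 2) ℂ) : Matrix (Fin 2) (Fin 2) ℂ) *ᵥ
      (((![1, pauliZ] b : unitaryGroup (Fin 2) ℂ) : Matrix (Fin 2) (Fin 2) ℂ) *ᵥ
        (((![1, phasedHadamard] z : unitaryGroup (Fin 2) ℂ) : Matrix (Fin 2) (Fin 2) ℂ) *ᵥ
          ket 0)) = ket (b * z) := by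
  ext i
  fin_cases b <;> fin_cases z <;> fin_cases i <;>
    simp [phasedHadamard, pauliZ, ket, Matrix.mulVec, dotProduct, star_apply,
      Complex.ext_iff] <;> norm_num

/-- `Implements` for basis states. -/
abbrev ImplementsBasis {Q ι I : Type} [Fintype Q] [DecidableEq ι] (E : Q ≃ ι) (N : ℕ)
    (x x' : I → Q → Fin 2) : Prop :=
  Implements E N (fun i q => ket (x i q)) (fun i q => ket (x' i q))

section

variable {Q ι I : Type} [Fintype Q] [DecidableEq ι] [DecidableEq Q] {E : Q ≃ ι}

/-- The qubits `c j` are dummy controls, with `X` applied in both branches; this way every layer is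
an instance of `implements_mux`. -/
theorem implementsBasis_not {κ : Type} [Fintype κ] (c t : κ → Q)
    (hinj : Function.Injective (Sum.elim c t)) (x x' : I → Q → Fin 2)
    (ht : ∀ i j, x' i (t j) = 1 + x i (t j))
    (h0 : ∀ i q, (∀ j, q ≠ t j) → x' i q = x i q) : ImplementsBasis E 1 x x' :=
  implements_mux c t hinj (fun _ _ => pauliX) _ _ (fun i j => x i (c j)) (fun _ _ => rfl)
    (fun i j => by rw [pauliX_mulVec_ket, ht]) fun i q hq => by rw [h0 i q hq]

theorem implementsBasis_cnot {κ : Type} [Fintype κ] (c t : κ → Q)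
    (hinj : Function.Injective (Sum.elim c t)) (x x' : I → Q → Fin 2)
    (ht : ∀ i j, x' i (t j) = x i (c j) + x i (t j))
    (h0 : ∀ i q, (∀ j, q ≠ t j) → x' i q = x i q) : ImplementsBasis E 1 x x' := by
  refine implements_mux c t hinj (fun _ => ![1, pauliX]) _ _ (fun i j => x i (c j))
    (fun _ _ => rfl) (fun i j => ?_) fun i q hq => by rw [h0 i q hq]
  rw [ht]
  rcases (by omega : x i (c j) = 0 ∨ x i (c j) = 1) with h | h <;> rw [h]
  · simp
  · exact (pauliX_mulVec_ket _).symm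

/-- Moving the bits `z j` to the blank qubits `t j` if the control `b j` is set. -/
theorem implementsBasis_move {κ : Type} [Fintype κ] (b z t : κ → Q)
    (hinj : Function.Injective (Sum.elim b (Sum.elim z t))) (x x' : I → Q → Fin 2)
    (ht0 : ∀ i j, x i (t j) = 0)
    (ht : ∀ i j, x' i (t j) = x i (b j) * x i (z j))
    (hz : ∀ i j, x' i (z j) = x i (b j) * x i (z j) + x i (z j))
    (h0 : ∀ i q, (∀ j, q ≠ t j) → (∀ j, q ≠ z j) → x' i q = x i q) :
    ImplementsBasis E 4 x x' := by
  classical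
  have hbt : Function.Injective (Sum.elim b t) := by
    rw [Sum.elim_injective] at hinj ⊢
    have := Sum.elim_injective.1 hinj.2.1
    exact ⟨hinj.1, this.2.1, fun i j => by simpa using hinj.2.2 i (.inr j)⟩
  have hzt : Function.Injective (Sum.elim z t) := (Sum.elim_injective.1 hinj).2.1
  have htz : Function.Injective (Sum.elim t z) := by
    rw [Sum.elim_injective] at hzt ⊢
    exact ⟨hzt.2.1, hzt.1, fun i j => (hzt.2.2 j i).symm⟩
  have hti : Function.Injective t := (Sum.elim_injective.1 hzt).2.1
  have hztne : ∀ i j, z i ≠ t j := (Sum.elim_injective.1 hzt).2.2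
  have hbtne : ∀ i j, b i ≠ t j := (Sum.elim_injective.1 hbt).2.2
  -- Between the first and the third layer the targets are not basis states, while all other qubits
  -- keep their kets.
  let upd : (κ → I → Fin 2 → ℂ) → I → Q → Fin 2 → ℂ := fun f i q =>
    if h : ∃ j, q = t j then f h.choose i else ket (x i q)
  have upd_t : ∀ f i j, upd f i (t j) = f j i := fun f i j => by
    have h : ∃ k, t j = t k := ⟨j, rfl⟩
    simp only [upd, dif_pos h]
    rw [← hti h.choose_spec]
  have upd_ne : ∀ f i q, (∀ j, q ≠ t j) → upd f i q = ket (x i q) := fun f i q hq => by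
    simp only [upd]
    rw [dif_neg (by simpa using hq)]
  let f₁ : κ → I → Fin 2 → ℂ := fun j i =>
    ((![1, phasedHadamard] (x i (z j)) : unitaryGroup (Fin 2) ℂ) : Matrix (Fin 2) (Fin 2) ℂ) *ᵥ
      ket 0
  let f₂ : κ → I → Fin 2 → ℂ := fun j i =>
    ((![1, pauliZ] (x i (b j)) : unitaryGroup (Fin 2) ℂ) : Matrix (Fin 2) (Fin 2) ℂ) *ᵥ f₁ j i
  let y : I → Q → Fin 2 := fun i q => if ∃ j, q = t j then x' i q else x i q
  have hy_t : ∀ i j, y i (t j) = x' i (t j) := fun i j => if_pos ⟨j, rfl⟩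
  have hy_ne : ∀ i q, (∀ j, q ≠ t j) → y i q = x i q := fun i q hq =>
    if_neg (by simpa using hq)
  have s₁ : Implements E 1 (fun i q => ket (x i q)) (upd f₁) :=
    implements_mux z t hzt (fun _ => ![1, phasedHadamard]) _ _ (fun i j => x i (z j))
      (fun _ _ => rfl) (fun i j => by rw [upd_t, ht0]) fun i q hq => upd_ne _ i q hq
  have s₂ : Implements E 1 (upd f₁) (upd f₂) :=
    implements_mux b t hbt (fun _ => ![1, pauliZ]) _ _ (fun i j => x i (b j))
      (fun i j => upd_ne _ i _ (hbtne j)) (fun i j => by rw [upd_t, upd_t])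
      fun i q hq => by rw [upd_ne _ i q hq, upd_ne _ i q hq]
  have s₃ : Implements E 1 (upd f₂) (fun i q => ket (y i q)) :=
    implements_mux z t hzt (fun _ => ![1, phasedHadamard⁻¹]) _ _ (fun i j => x i (z j))
      (fun i j => upd_ne _ i _ (hztne j))
      (fun i j => by rw [upd_t, hy_t, ht]; exact (phasedHadamard_conj _ _).symm)
      fun i q hq => by rw [upd_ne _ i q hq, hy_ne i q hq]
  -- The target now holds `b * z`; adding it to the source erases the source exactly when the bit
  -- was moved.
  have s₄ : ImplementsBasis E 1 y x' :=
    implementsBasis_cnot t z htz _ _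
      (fun i j => by rw [hz, hy_t, ht, hy_ne _ _ (hztne j)])
      fun i q hq => by
        by_cases h : ∃ j, q = t j
        · obtain ⟨j, rfl⟩ := h
          exact (hy_t i j).symm
        · push Not at h
          rw [hy_ne i q h, h0 i q h hq]
  exact ((s₁.trans s₂).trans s₃).trans s₄

end

/-! ### Routing the word register to the position given by the index register -/

/-- For every word qubit, a lane which carries a flag and a lane which carries its state. -/
abbrev Lane (n : ℕ) : Type := Fin n × Fin 2

/-- The index register, the word register, and for every lane `2 ^ m` qubits for its data and
`2 ^ m` qubits for copies of the index bits. -/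
abbrev Register (m n : ℕ) : Type :=
  Fin m ⊕ Fin n ⊕ (Lane n × Fin (2 ^ m)) ⊕ (Lane n × Fin (2 ^ m))

section

variable {m n : ℕ}

abbrev Register.index (j : Fin m) : Register m n := .inl j

abbrev Register.word (l : Fin n) : Register m n := .inr (.inl l)

abbrev Register.data (p : Lane n) (x : Fin (2 ^ m)) : Register m n := .inr (.inr (.inl (p, x)))

abbrev Register.control (p : Lane n) (y : Fin (2 ^ m)) : Register m n :=
  .inr (.inr (.inr (p, y)))

open Register

/-- The binary digit of `k` of weight `2 ^ j`. -/
def bit (k j : ℕ) : Fin 2 := if k.testBit j then 1 else 0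

/-- The assignment of bits with contents `k` and `w` of the index and word registers. -/
def config (k : ℕ) (w : Fin n → Fin 2) (D c : Lane n → Fin (2 ^ m) → Fin 2) :
    Register m n → Fin 2 :=
  Sum.elim (fun j => bit k j) (Sum.elim w (Sum.elim (fun q => D q.1 q.2) fun q => c q.1 q.2))

/-- A flag that is set, and the word. -/
def payload (z : Fin n → Fin 2) (p : Lane n) : Fin 2 := if p.2 = 0 then 1 else z p.1

/-- The data qubits after `t` levels of routing. -/
def treeData (k : ℕ) (z : Fin n → Fin 2) (t : ℕ) (p : Lane n) (x : Fin (2 ^ m)) : Fin 2 :=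
  if x.val = k % 2 ^ t then payload z p else 0

/-- The copies of the index bits when they have been distributed to the first `2 ^ s` pairs of
lanes, and bit `j` to the qubits `2 ^ j + x` with `x < 2 ^ t` of each lane. -/
def treeControl (k s t : ℕ) (p : Lane n) (y : Fin (2 ^ m)) : Fin 2 :=
  if p.1.val < 2 ^ s ∧ y.val ≠ 0 ∧ y.val - 2 ^ Nat.log 2 y < 2 ^ t then bit k (Nat.log 2 y)
  else 0

theorem log_two_pow_add {j x : ℕ} (hx : x < 2 ^ j) : Nat.log 2 (2 ^ j + x) = j := by
  rw [Nat.log_eq_iff (by right; constructor <;> [norm_num; positivity]), pow_succ]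
  omega

theorem two_pow_add_lt {t x : ℕ} (ht : t < m) (hx : x < 2 ^ t) : 2 ^ t + x < 2 ^ m := by
  have := Nat.pow_le_pow_right (n := 2) (by norm_num) ht
  rw [Nat.pow_succ] at this
  omega

theorem mod_two_pow_succ_eq (k t : ℕ) :
    k % 2 ^ (t + 1) = k % 2 ^ t + if bit k t = 1 then 2 ^ t else 0 := by
  rw [Nat.mod_pow_succ, bit, Nat.testBit_eq_decide_div_mod_eq]
  rcases Nat.mod_two_eq_zero_or_one (k / 2 ^ t) with h | h <;> simp [h]

variable {ι : Type} [DecidableEq ι] {E : Register m n ≃ ι}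

/-- The inputs: a position and the contents of the word register. -/
abbrev Input (m n : ℕ) : Type := Fin (2 ^ m) × (Fin n → Fin 2)

theorem implementsBasis_load :
    ImplementsBasis E 3 (fun i : Input m n => config i.1 i.2 0 0)
      (fun i => config i.1 0 (treeData i.1 i.2 0) 0) := by
  have h0 : 0 < 2 ^ m := by positivity
  have s₁ : ImplementsBasis E 1 (fun i : Input m n => config i.1 i.2 0 0)
      (fun i => config i.1 i.2 (fun p x => if x.val = 0 ∧ p.2 = 0 then 1 else 0) 0) := by
    -- The word qubits serve only as dummy controls while the flags are set.
    refine implementsBasis_not (fun l => word l) (fun l => data (l, 0) ⟨0, h0⟩) ?_ _ _ ?_ ?_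
    · rw [Sum.elim_injective]
      refine ⟨fun a b h => by simpa using h, fun a b h => by simpa using h, by simp⟩
    · intro i j
      simp [config]
    · rintro i (q | q | ⟨p, q⟩ | q) hq <;> simp [config] at hq ⊢
      grind
  have s₂ : ImplementsBasis E 1
      (fun i : Input m n => config i.1 i.2 (fun p x => if x.val = 0 ∧ p.2 = 0 then 1 else 0) 0)
      (fun i => config i.1 i.2 (treeData i.1 i.2 0) 0) := by
    refine implementsBasis_cnot (fun l => word l) (fun l => data (l, 1) ⟨0, h0⟩) ?_ _ _ ?_ ?_
    · rw [Sum.elim_injective]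
      refine ⟨fun a b h => by simpa using h, fun a b h => by simpa using h, by simp⟩
    · intro i j
      simp [config, treeData, payload, Nat.mod_one]
    · rintro i (q | q | ⟨⟨l, f⟩, q⟩ | q) hq <;>
        simp [config, treeData, payload, Nat.mod_one] at hq ⊢
      rcases (by omega : f = 0 ∨ f = 1) with rfl | rfl <;> simp_all
  -- The word qubit and its copy agree, so adding the copy back clears the word register.
  have s₃ : ImplementsBasis E 1
      (fun i : Input m n => config i.1 i.2 (treeData i.1 i.2 0) 0)
      (fun i => config i.1 0 (treeData i.1 i.2 0) 0) := by
    refine implementsBasis_cnot (fun l => data (l, 1) ⟨0, h0⟩) (fun l => word l) ?_ _ _ ?_ ?_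
    · rw [Sum.elim_injective]
      refine ⟨fun a b h => by simpa using h, fun a b h => by simpa using h, by simp⟩
    · intro i j
      simp only [config, treeData, payload, Sum.elim_inr, Sum.elim_inl, Pi.zero_apply, pow_zero,
        Nat.mod_one, one_ne_zero, if_true, if_false]
      generalize i.2 j = b
      revert b
      decide
    · rintro i (q | q | ⟨p, q⟩ | q) hq <;> simp [config] at hq ⊢
  exact (s₁.trans s₂).trans s₃

/-- Copying bits into blank control qubits. -/
theorem implementsBasis_copy {I κ : Type} [Fintype κ] (a : κ → Register m n)
    (t : κ → Lane n × Fin (2 ^ m)) (ht : Function.Injective t)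
    (hat : ∀ i j, a i ≠ control (t j).1 (t j).2) (ha : Function.Injective a)
    (k : I → ℕ) (w : I → Fin n → Fin 2) (D c c' : I → Lane n → Fin (2 ^ m) → Fin 2)
    (hc : ∀ i j, c i (t j).1 (t j).2 = 0)
    (hc' : ∀ i j, c' i (t j).1 (t j).2 = config (k i) (w i) (D i) (c i) (a j))
    (h0 : ∀ i p y, (∀ j, (p, y) ≠ t j) → c' i p y = c i p y) :
    ImplementsBasis E 1 (fun i => config (k i) (w i) (D i) (c i))
      (fun i => config (k i) (w i) (D i) (c' i)) := by
  refine implementsBasis_cnot a (fun j => control (t j).1 (t j).2) ?_ _ _ ?_ ?_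
  · rw [Sum.elim_injective]
    exact ⟨ha, fun i j h => ht (by simpa using h), hat⟩
  · intro i j
    rw [show config (k i) (w i) (D i) (c' i) (control (t j).1 (t j).2) = _ from hc' i j,
      show config (k i) (w i) (D i) (c i) (control (t j).1 (t j).2) = 0 from hc i j, add_zero]
  · rintro i (q | q | q | ⟨p, y⟩) hq
    · rfl
    · rfl
    · rfl
    · exact h0 i p y fun j h => hq j (by simp [← h])

/-- Both lanes of the first pair read the same index qubits, which forces two layers. At this stage
the seed of bit `j` is the single control qubit `2 ^ j`. -/
theorem implementsBasis_fanout_zero (hn : 0 < n) {I : Type} (k : I → ℕ)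
    (w : I → Fin n → Fin 2) (D : I → Lane n → Fin (2 ^ m) → Fin 2) :
    ImplementsBasis E 2 (fun i => config (k i) (w i) (D i) 0)
      (fun i => config (k i) (w i) (D i) (treeControl (k i) 0 0)) := by
  have hpow : ∀ j : Fin m, 2 ^ (j : ℕ) < 2 ^ m := fun j =>
    Nat.pow_lt_pow_right (by norm_num) j.2
  have hinj : ∀ f : Fin 2, Function.Injective
      (fun j : Fin m => (((⟨0, hn⟩, f) : Lane n), (⟨2 ^ (j : ℕ), hpow j⟩ : Fin (2 ^ m)))) :=
    fun f i j h => by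
      simp only [Prod.mk.injEq, true_and, Fin.mk.injEq] at h
      exact Fin.ext (Nat.pow_right_injective le_rfl h)
  have hy : ∀ y : ℕ, y ≠ 0 → y - 2 ^ Nat.log 2 y < 2 ^ 0 → y = 2 ^ Nat.log 2 y := fun y h0 h => by
    have := Nat.pow_log_le_self 2 h0
    omega
  have hlog : ∀ y : Fin (2 ^ m), y.val ≠ 0 → Nat.log 2 y < m := fun y h0 =>
    Nat.log_lt_of_lt_pow h0 y.2
  have s₁ : ImplementsBasis E 1 (fun i => config (k i) (w i) (D i) 0)
      (fun i => config (k i) (w i) (D i)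
        (fun p y => if p.2 = 0 then treeControl (k i) 0 0 p y else 0)) := by
    refine implementsBasis_copy (fun j => index j) _ (hinj 0) (by simp)
      (fun i j h => by simpa using h) _ _ _ _ _ (by simp) ?_ ?_
    · intro i j
      simp [config, treeControl, Nat.log_pow]
    · intro i p y h
      simp only [treeControl, Pi.zero_apply, ite_eq_right_iff]
      rintro hp ⟨h1, h2, h3⟩
      refine absurd ?_ (h ⟨Nat.log 2 y, hlog y h2⟩)
      obtain ⟨⟨l, _⟩, f⟩ := p
      simp only [pow_zero, Nat.lt_one_iff] at h1
      simp only at hp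
      subst h1 hp
      simp only [Prod.mk.injEq, true_and]
      exact Fin.ext (hy y h2 h3)
  have s₂ : ImplementsBasis E 1 (fun i => config (k i) (w i) (D i)
        (fun p y => if p.2 = 0 then treeControl (k i) 0 0 p y else 0))
      (fun i => config (k i) (w i) (D i) (treeControl (k i) 0 0)) := by
    refine implementsBasis_copy (fun j => index j) _ (hinj 1) (by simp)
      (fun i j h => by simpa using h) _ _ _ _ _ (by simp) ?_ ?_
    · intro i j
      simp [config, treeControl, Nat.log_pow]
    · intro i p y h
      simp only [left_eq_ite_iff]
      intro hp
      simp only [treeControl, ite_eq_right_iff]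
      rintro ⟨h1, h2, h3⟩
      refine absurd ?_ (h ⟨Nat.log 2 y, hlog y h2⟩)
      obtain ⟨⟨l, _⟩, f⟩ := p
      simp only [pow_zero, Nat.lt_one_iff] at h1
      simp only at hp
      have hp : f = 1 := by omega
      subst h1 hp
      simp only [Prod.mk.injEq, true_and]
      exact Fin.ext (hy y h2 h3)
  exact s₁.trans s₂

/-- Doubling: lane pair `l < 2 ^ s` is copied to `l + 2 ^ s`, whenever that pair exists. -/
theorem implementsBasis_fanout_succ (s : ℕ) {I : Type} (k : I → ℕ)
    (w : I → Fin n → Fin 2) (D : I → Lane n → Fin (2 ^ m) → Fin 2) :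
    ImplementsBasis E 1 (fun i => config (k i) (w i) (D i) (treeControl (k i) s 0))
      (fun i => config (k i) (w i) (D i) (treeControl (k i) (s + 1) 0)) := by
  refine implementsBasis_copy
    (κ := {l : Fin n // l.val < 2 ^ s ∧ l.val + 2 ^ s < n} × Fin 2 × Fin (2 ^ m))
    (fun j => control (j.1.1, j.2.1) j.2.2)
    (fun j => ((⟨j.1.1.val + 2 ^ s, j.1.2.2⟩, j.2.1), j.2.2)) ?_ ?_ ?_ _ _ _ _ _ ?_ ?_ ?_
  · rintro ⟨⟨l, hl⟩, f, y⟩ ⟨⟨l', hl'⟩, f', y'⟩ h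
    simp only [Prod.mk.injEq, Fin.mk.injEq, Nat.add_right_cancel_iff] at h
    simp [h, Fin.ext_iff]
  · rintro ⟨⟨l, hl⟩, f, y⟩ ⟨⟨l', hl'⟩, f', y'⟩ h
    simp only [Sum.inr.injEq, Prod.mk.injEq, Fin.ext_iff] at h
    omega
  · rintro ⟨⟨l, hl⟩, f, y⟩ ⟨⟨l', hl'⟩, f', y'⟩ h
    simp only [Sum.inr.injEq, Prod.mk.injEq] at h
    simp [h]
  · rintro i ⟨⟨l, hl⟩, f, y⟩
    simp [treeControl]
  · rintro i ⟨⟨l, hl⟩, f, y⟩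
    have : l.val + 2 ^ s < 2 ^ (s + 1) := by rw [pow_succ]; omega
    simp [treeControl, config, hl, this]
  · rintro i ⟨l, f⟩ y h
    have hl : l.val < 2 ^ (s + 1) ↔ l.val < 2 ^ s := by
      refine ⟨fun h1 => ?_, fun h1 => by rw [pow_succ]; omega⟩
      by_contra h2
      rw [pow_succ] at h1
      refine h ⟨⟨⟨l.val - 2 ^ s, by omega⟩, by simp only; omega, by simp only; omega⟩, f, y⟩ ?_
      simp only [Prod.mk.injEq, Fin.ext_iff, and_true]
      omega
    simp only [treeControl, hl]

theorem implementsBasis_fanout (hn : 0 < n) {I : Type} (k : I → ℕ)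
    (w : I → Fin n → Fin 2) (D : I → Lane n → Fin (2 ^ m) → Fin 2) (s : ℕ) :
    ImplementsBasis E (2 + s) (fun i => config (k i) (w i) (D i) 0)
      (fun i => config (k i) (w i) (D i) (treeControl (k i) s 0)) := by
  induction s with
  | zero => exact implementsBasis_fanout_zero hn k w D
  | succ s ih => exact ih.trans (implementsBasis_fanout_succ s k w D)

/-- Since `k % 2 ^ (t + 1)` is `k % 2 ^ t` plus `2 ^ t` times bit `t`, a payload at `x < 2 ^ t`
moves to `2 ^ t + x` exactly when bit `t` is set. Control qubit `2 ^ t + x` holds a private copy of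
that bit, so all moves run in parallel. -/
theorem implementsBasis_move_level {s t : ℕ} (hs : n ≤ 2 ^ s) (ht : t < m)
    (w : Fin n → Fin 2) :
    ImplementsBasis E 4
      (fun i : Input m n => config i.1 w (treeData i.1 i.2 t) (treeControl i.1 s t))
      (fun i => config i.1 w (treeData i.1 i.2 (t + 1)) (treeControl i.1 s t)) := by
  have hk : ∀ k : ℕ, k % 2 ^ t < 2 ^ t := fun k => Nat.mod_lt _ (by positivity)
  refine implementsBasis_move (κ := Lane n × {x : Fin (2 ^ m) // x.val < 2 ^ t})
    (fun j => control j.1 ⟨2 ^ t + j.2.1.val, two_pow_add_lt ht j.2.2⟩)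
    (fun j => data j.1 j.2.1)
    (fun j => data j.1 ⟨2 ^ t + j.2.1.val, two_pow_add_lt ht j.2.2⟩) ?_ _ _ ?_ ?_ ?_ ?_
  · rw [Sum.elim_injective, Sum.elim_injective]
    refine ⟨?_, ⟨?_, ?_, ?_⟩, ?_⟩
    · rintro ⟨p, x, hx⟩ ⟨p', x', hx'⟩ h
      simp only [Sum.inr.injEq, Prod.mk.injEq, Fin.mk.injEq, Nat.add_left_cancel_iff] at h
      simp [h, Fin.ext_iff]
    · rintro ⟨p, x, hx⟩ ⟨p', x', hx'⟩ h
      simpa using h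
    · rintro ⟨p, x, hx⟩ ⟨p', x', hx'⟩ h
      simp only [Sum.inr.injEq, Sum.inl.injEq, Prod.mk.injEq, Fin.mk.injEq,
        Nat.add_left_cancel_iff] at h
      simp [h, Fin.ext_iff]
    · rintro ⟨p, x, hx⟩ ⟨p', x', hx'⟩ h
      simp only [Sum.inr.injEq, Sum.inl.injEq, Prod.mk.injEq, Fin.ext_iff] at h
      omega
    · rintro j (j' | j') <;> simp
  · rintro i ⟨p, x, hx⟩
    have := hk i.1
    simp only [config, treeData, Sum.elim_inr, Sum.elim_inl]
    rw [if_neg (by omega)]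
  · rintro i ⟨p, x, hx⟩
    have := hk i.1
    have hp := p.1.2.trans_le hs
    simp only [config, treeData, treeControl, Sum.elim_inr, Sum.elim_inl, log_two_pow_add hx,
      mod_two_pow_succ_eq]
    rw [if_pos (c := _ ∧ _) ⟨hp, by positivity, by omega⟩]
    rcases (by omega : bit i.1 t = 0 ∨ bit i.1 t = 1) with h | h <;> rw [h]
    · simp only [zero_ne_one, if_false, zero_mul]
      rw [if_neg (by omega)]
    · simp only [if_true, one_mul, Nat.add_comm _ (2 ^ t), Nat.add_left_cancel_iff]
  · rintro i ⟨p, x, hx⟩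
    have := hk i.1
    have hp := p.1.2.trans_le hs
    simp only [config, treeData, treeControl, Sum.elim_inr, Sum.elim_inl, log_two_pow_add hx,
      mod_two_pow_succ_eq]
    rw [if_pos (c := _ ∧ _) ⟨hp, by positivity, by omega⟩]
    rcases (by omega : bit i.1 t = 0 ∨ bit i.1 t = 1) with h | h <;> rw [h]
    · simp
    · simp only [if_true, one_mul]
      rw [if_neg (by omega)]
      generalize payload i.2 p = b
      split_ifs <;> revert b <;> decide
  · rintro i (q | q | ⟨p, x⟩ | q) h1 h2
    · rfl
    · rfl
    · simp only [config, treeData, Sum.elim_inr, Sum.elim_inl]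
      have hk1 := hk i.1
      have hk2 : i.1.val % 2 ^ (t + 1) < 2 ^ (t + 1) := Nat.mod_lt _ (by positivity)
      have h3 : ¬ x.val < 2 ^ t := fun h => h2 (p, ⟨x, h⟩) rfl
      have h4 : ¬ x.val < 2 ^ (t + 1) := fun h => by
        rw [pow_succ] at h
        refine h1 (p, ⟨⟨x.val - 2 ^ t, by omega⟩, by simp only; omega⟩) ?_
        simp only [Sum.inr.injEq, Sum.inl.injEq, Prod.mk.injEq, true_and, Fin.ext_iff]
        omega
      rw [if_neg (by omega), if_neg (by omega)]
    · rfl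

/-- The control qubits in `[2 ^ j, 2 ^ (j + 1))` are reserved for bit `j`. Blocks with `j ≤ t` are
already full; the others double their copies, so that block `t + 1` is full when its level is
reached. -/
theorem implementsBasis_copy_level {s t : ℕ} {I : Type} (k : I → ℕ)
    (w : I → Fin n → Fin 2) (D : I → Lane n → Fin (2 ^ m) → Fin 2) :
    ImplementsBasis E 1 (fun i => config (k i) (w i) (D i) (treeControl (k i) s t))
      (fun i => config (k i) (w i) (D i) (treeControl (k i) s (t + 1))) := by
  have key : ∀ y : ℕ, y ≠ 0 → t < Nat.log 2 y → y - 2 ^ Nat.log 2 y < 2 ^ t →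
      Nat.log 2 (y + 2 ^ t) = Nat.log 2 y ∧ y + 2 ^ t < 2 ^ (Nat.log 2 y + 1) := by
    intro y h0 h1 h2
    have h3 := Nat.pow_log_le_self 2 h0
    have h4 := Nat.pow_le_pow_right (n := 2) (by norm_num) h1
    rw [Nat.pow_succ] at h4
    have h5 : y + 2 ^ t < 2 ^ (Nat.log 2 y + 1) := by rw [pow_succ]; omega
    refine ⟨?_, h5⟩
    rw [Nat.log_eq_iff (by right; constructor <;> [norm_num; omega])]
    omega
  have hlt : ∀ y : Fin (2 ^ m), y.val ≠ 0 → 2 ^ (Nat.log 2 y + 1) ≤ 2 ^ m := fun y h0 =>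
    Nat.pow_le_pow_right (by norm_num) (Nat.log_lt_of_lt_pow h0 y.2)
  refine implementsBasis_copy
    (κ := Lane n × {y : Fin (2 ^ m) // y.val ≠ 0 ∧ t < Nat.log 2 y ∧
      y.val - 2 ^ Nat.log 2 y < 2 ^ t})
    (fun j => control j.1 j.2.1)
    (fun j => (j.1, ⟨j.2.1.val + 2 ^ t, (key _ j.2.2.1 j.2.2.2.1 j.2.2.2.2).2.trans_le
      (hlt _ j.2.2.1)⟩)) ?_ ?_ ?_ _ _ _ _ _ ?_ ?_ ?_
  · rintro ⟨p, y, hy⟩ ⟨p', y', hy'⟩ h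
    simp only [Prod.mk.injEq, Fin.mk.injEq, Nat.add_right_cancel_iff] at h
    simp [h, Fin.ext_iff]
  · rintro ⟨p, y, hy⟩ ⟨p', y', hy'⟩ h
    simp only [Sum.inr.injEq, Prod.mk.injEq, Fin.ext_iff] at h
    have h1 := (key y' hy'.1 hy'.2.1 hy'.2.2).1
    have h2 := Nat.pow_log_le_self 2 hy'.1
    have h3 := hy.2.2
    rw [h.2, h1] at h3
    omega
  · rintro ⟨p, y, hy⟩ ⟨p', y', hy'⟩ h
    simpa using h
  · rintro i ⟨p, y, hy⟩
    have h1 := (key y hy.1 hy.2.1 hy.2.2).1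
    have h2 := Nat.pow_log_le_self 2 hy.1
    simp only [treeControl, h1]
    rw [if_neg (by omega)]
  · rintro i ⟨p, y, hy⟩
    have h1 := (key y hy.1 hy.2.1 hy.2.2).1
    have h2 := Nat.pow_log_le_self 2 hy.1
    simp only [treeControl, config, Sum.elim_inr, h1]
    have h3 := hy.2.2
    refine if_congr ?_ rfl rfl
    rw [pow_succ]
    omega
  · rintro i p y h
    simp only [treeControl]
    refine if_congr (and_congr_right fun _ => and_congr_right fun h0 => ?_) rfl rfl
    refine ⟨fun h1 => ?_, fun h1 => by rw [pow_succ]; omega⟩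
    by_contra h2
    rw [pow_succ] at h1
    have h3 := Nat.lt_pow_succ_log_self (b := 2) (by norm_num) y.val
    rw [pow_succ] at h3
    -- A newly filled qubit has offset at least `2 ^ t` in its block, so the block is longer than `2
    -- ^ t` and `y - 2 ^ t` lies in the same block.
    have h4 : t < Nat.log 2 y := (Nat.pow_lt_pow_iff_right (a := 2) (by norm_num)).1 (by omega)
    have h5 : Nat.log 2 (y.val - 2 ^ t) = Nat.log 2 y := by
      rw [Nat.log_eq_iff (by right; constructor <;> [norm_num; omega]), pow_succ]
      omega
    have h6 : 0 < 2 ^ Nat.log 2 y.val := by positivity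
    refine h (p, ⟨⟨y.val - 2 ^ t, by omega⟩, by simp only; omega, by simp only; omega, ?_⟩) ?_
    · simp only [h5]
      omega
    · simp only [Prod.mk.injEq, true_and, Fin.ext_iff]
      omega

/-- Routing the word to the position given by the index, along with a flag. -/
theorem implementsBasis_route (hn : 0 < n) :
    ImplementsBasis E (5 + Nat.clog 2 n + 5 * m) (fun i : Input m n => config i.1 i.2 0 0)
      (fun i => config i.1 0 (treeData i.1 i.2 m) (treeControl i.1 (Nat.clog 2 n) m)) := by
  -- Loading costs 3 layers and fan-out `2 + Nat.clog 2 n`; each level costs 4 for the move and 1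
  -- for the copies.
  have h : ∀ t ≤ m, ImplementsBasis E (5 + Nat.clog 2 n + 5 * t)
      (fun i : Input m n => config i.1 i.2 0 0)
      (fun i => config i.1 0 (treeData i.1 i.2 t) (treeControl i.1 (Nat.clog 2 n) t)) := by
    intro t
    induction t with
    | zero =>
      intro _
      have := implementsBasis_load.trans
        (implementsBasis_fanout (E := E) hn (fun i : Input m n => i.1.val) (fun _ => 0)
          (fun i => treeData i.1 i.2 0) (Nat.clog 2 n))
      rwa [show 5 + Nat.clog 2 n + 5 * 0 = 3 + (2 + Nat.clog 2 n) by omega]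
    | succ t ih =>
      intro ht
      have := ((ih (by omega)).trans (implementsBasis_move_level
        (Nat.le_pow_clog (by norm_num) n) ht 0)).trans
          (implementsBasis_copy_level (fun i : Input m n => i.1.val) (fun _ => 0)
          (fun i => treeData i.1 i.2 (t + 1)))
      rwa [show 5 + Nat.clog 2 n + 5 * (t + 1) = 5 + Nat.clog 2 n + 5 * t + 4 + 1 by omega]
  exact h m le_rfl

end

open Register

/-! ### Expansions in the computational basis -/

theorem productState_ket {Q ι : Type} [Fintype Q] (E : Q ≃ ι) (b : Q → Fin 2) (x : ι → Fin 2) :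
    productState E (fun q => ket (b q)) x = if ∀ q, x (E q) = b q then 1 else 0 := by
  simp only [productState, ket, Pi.single_apply]
  exact Fintype.prod_boole

/-- Multilinearity of the tensor product in the factors at the qubits `r l`. -/
theorem productState_expand {Q ι : Type} [Fintype Q] [DecidableEq Q] {n : ℕ} (E : Q ≃ ι)
    {r : Fin n → Q} (hr : Function.Injective r) (w : Fin n → Fin 2 → ℂ) (v : Q → Fin 2 → ℂ)
    (v' : (Fin n → Fin 2) → Q → Fin 2 → ℂ) (hv : ∀ l, v (r l) = w l)
    (hv' : ∀ z l, v' z (r l) = ket (z l)) (h0 : ∀ z q, (∀ l, q ≠ r l) → v q = v' z q) :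
    productState E v = ∑ z, (∏ l, w l (z l)) • productState E (v' z) := by
  funext x
  have hsplit : ∀ f : Q → ℂ, ∏ q, f q = (∏ l, f (r l)) * ∏ q ∈ (Finset.univ.image r)ᶜ, f q := by
    intro f
    rw [← Finset.prod_mul_prod_compl (Finset.univ.image r), Finset.prod_image hr.injOn]
  have hrest : ∀ z, ∏ q ∈ (Finset.univ.image r)ᶜ, v q (x (E q)) =
      ∏ q ∈ (Finset.univ.image r)ᶜ, v' z q (x (E q)) := fun z =>
    Finset.prod_congr rfl fun q hq => by
      rw [h0 z q fun l hl => by simp [hl] at hq]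
  simp only [Finset.sum_apply, Pi.smul_apply, smul_eq_mul, productState, hsplit, hv, hv',
    ← hrest]
  rw [Finset.sum_eq_single fun l => x (E (r l))]
  · simp [ket]
  · intro z _ hz
    obtain ⟨l, hl⟩ := Function.ne_iff.1 hz
    have : ∏ l, ket (z l) (x (E (r l))) = 0 :=
      Finset.prod_eq_zero (Finset.mem_univ l) (by simp [ket, Ne.symm hl])
    rw [this]
    simp
  · simp

theorem Implements.comap {Q ι I J : Type} [Fintype Q] [DecidableEq ι] {E : Q ≃ ι} {N : ℕ}
    {v v' : I → Q → Fin 2 → ℂ} (h : Implements E N v v') (f : J → I) :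
    Implements E N (fun j => v (f j)) (fun j => v' (f j)) := by
  obtain ⟨C, hC, h⟩ := h
  exact ⟨C, hC, fun j => h (f j)⟩

/-! ### Applying the unitaries -/

/-- The states of the qubits after routing and applying `U k` to the routed word. -/
def appliedState {m n d : ℕ} (U : ProductUnitaryFunction n d) (s : ℕ)
    (i : Fin d × (Fin n → Fin 2)) (q : Register m n) : Fin 2 → ℂ :=
  match q with
  | .inr (.inr (.inl ((l, f), x))) =>
    if f = 1 ∧ x.val = i.1.val then (U l i.1 : Matrix (Fin 2) (Fin 2) ℂ) *ᵥ ket (i.2 l)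
    else ket (treeData i.1 i.2 m (l, f) x)
  | q => ket (config i.1 0 (treeData i.1 i.2 m) (treeControl i.1 s m) q)

theorem implements_apply {m n d : ℕ} (hd : d ≤ 2 ^ m) {ι : Type} [DecidableEq ι]
    {E : Register m n ≃ ι} (U : ProductUnitaryFunction n d) (s : ℕ) :
    Implements E 1
      (fun i : Fin d × (Fin n → Fin 2) => fun q =>
        ket (config i.1 0 (treeData i.1 i.2 m) (treeControl i.1 s m) q))
      (appliedState U s) := by
  have hmod : ∀ k : Fin d, k.val % 2 ^ m = k.val := fun k => Nat.mod_eq_of_lt (k.2.trans_le hd)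
  refine implements_mux (κ := Fin n × Fin d)
    (fun j => data (j.1, 0) ⟨j.2, j.2.2.trans_le hd⟩)
    (fun j => data (j.1, 1) ⟨j.2, j.2.2.trans_le hd⟩) ?_
    -- The identity on an unset flag keeps unused positions blank, as the reversal of the routing
    -- requires.
    (fun j => ![1, ⟨U j.1 j.2, specialUnitaryGroup_le_unitaryGroup (U j.1 j.2).2⟩]) _ _
    (fun i j => if j.2 = i.1 then 1 else 0) ?_ ?_ ?_
  · rw [Sum.elim_injective]
    refine ⟨?_, ?_, by simp⟩ <;>
    · rintro ⟨l, k⟩ ⟨l', k'⟩ h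
      simpa [Fin.ext_iff] using h
  · rintro i ⟨l, k⟩
    simp only [config, treeData, payload, hmod, Sum.elim_inr, Sum.elim_inl, if_true]
    exact congrArg ket (if_congr Fin.ext_iff.symm rfl rfl)
  · rintro i ⟨l, k⟩
    simp only [appliedState, config, treeData, payload, hmod, Sum.elim_inr, Sum.elim_inl, true_and]
    by_cases h : k = i.1
    · subst h
      simp
    · have h' : ¬ k.val = i.1.val := fun h' => h (Fin.ext h')
      simp [h, h']
  · rintro i (q | q | ⟨⟨l, f⟩, x⟩ | q) hq
    · rfl
    · rfl
    · simp only [appliedState]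
      rw [if_neg]
      · rfl
      · rintro ⟨rfl, hx⟩
        exact hq (l, i.1) (by simp [← hx])
    · rfl

theorem exists_circuit_basis {m n d : ℕ} (hn : 0 < n) (hd : d ≤ 2 ^ m) {ι : Type}
    [DecidableEq ι] (E : Register m n ≃ ι) (U : ProductUnitaryFunction n d) :
    ∃ C : Circuit ι, C.depth ≤ 2 * (5 + Nat.clog 2 n + 5 * m) + 1 ∧
      ∀ (k : Fin d) (z : Fin n → Fin 2),
        C.run (productState E fun q => ket (config k z 0 0 q)) =
          ∑ z', U.unitary k z' z • productState E fun q => ket (config k z' 0 0 q) := by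
  have hroute := (implementsBasis_route (m := m) (E := E) hn).comap
    (fun i : Fin d × (Fin n → Fin 2) => ((⟨i.1, i.1.2.trans_le hd⟩ : Fin (2 ^ m)), i.2))
  have hmod : ∀ k : Fin d, k.val % 2 ^ m = k.val := fun k => Nat.mod_eq_of_lt (k.2.trans_le hd)
  -- `C₁` routes and applies `U k`; `C` only routes and serves to define the reversal `C'`. All that
  -- matters is that both follow the same prescription on basis inputs.
  obtain ⟨C₁, hC₁, hrun₁⟩ := hroute.trans (implements_apply hd U _)
  obtain ⟨C, hC, hrun⟩ := hroute
  obtain ⟨C', hC', hinv⟩ := C.exists_inverse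
  obtain ⟨A, hA⟩ := C'.exists_linearMap
  refine ⟨C₁ ++ C', ?_, fun k z => ?_⟩
  · simp only [Circuit.depth, List.length_append] at *
    omega
  rw [Circuit.run_append, hrun₁ (k, z),
    productState_expand E (r := fun l => data (l, 1) ⟨k, k.2.trans_le hd⟩)
      (fun a b h => by simpa using h)
      (fun l => (U l k : Matrix (Fin 2) (Fin 2) ℂ) *ᵥ ket (z l)) _
      (fun z' q => ket (config k 0 (treeData k z' m) (treeControl k (Nat.clog 2 n) m) q)),
    hA, map_sum]
  · refine Finset.sum_congr rfl fun z' _ => ?_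
    rw [map_smul, ← hA]
    have := hrun (k, z')
    simp only at this
    rw [← this, hinv]
    congr 1
    simp [ProductUnitaryFunction.unitary, ket]
  · intro l
    simp [appliedState]
  · intro z' l
    simp [config, treeData, payload, hmod]
  · rintro z' (q | q | ⟨⟨l, f⟩, x⟩ | q) hq
    · rfl
    · rfl
    · simp only [appliedState, config, treeData, payload, hmod, Sum.elim_inr, Sum.elim_inl]
      by_cases hx : x.val = k.val
      · have hf : f = 0 := by
          by_contra hf
          have hf : f = 1 := by omega
          exact hq l (by simp [hf, ← hx])
        simp [hf]
      · simp [hx]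
    · rfl

/-! ### The selector -/

theorem indexBits_injective {d : ℕ} : Function.Injective (indexBits (d := d)) := by
  intro k k' h
  refine Fin.ext (Nat.eq_of_testBit_eq fun i => ?_)
  by_cases hi : i < Nat.clog 2 d
  · have := congrFun h ⟨i, hi⟩
    simp only [indexBits] at this
    cases h1 : k.val.testBit i <;> cases h2 : k'.val.testBit i <;> simp [h1, h2] at this ⊢
  · have hd : d ≤ 2 ^ i := (Nat.le_pow_clog (by norm_num) d).trans
      (Nat.pow_le_pow_right (by norm_num) (by omega))
    rw [Nat.testBit_lt_two_pow (k.2.trans_le hd), Nat.testBit_lt_two_pow (k'.2.trans_le hd)]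

theorem select_mulVec_apply {n d : ℕ} (U : ProductUnitaryFunction n d)
    (ψ : (Fin (Nat.clog 2 d) → Fin 2) × (Fin n → Fin 2) → ℂ) (x : Fin (Nat.clog 2 d) → Fin 2)
    (z' : Fin n → Fin 2) :
    ((select U).mulVec ψ) (x, z') =
      ∑ k, if indexBits k = x then ∑ z, U.unitary k z' z * ψ (indexBits k, z) else 0 := by
  simp only [select, Matrix.sum_mulVec, Finset.sum_apply]
  refine Finset.sum_congr rfl fun k _ => ?_
  simp only [Matrix.mulVec, dotProduct, Fintype.sum_prod_type, Matrix.kroneckerMap_apply,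
    Matrix.single_apply]
  split_ifs with h
  · rw [Finset.sum_eq_single (indexBits k)]
    · simp [h]
    · intro y _ hy
      simp [hy.symm]
    · simp
  · simp [h]

/-- The qubits of the circuit for the selector. -/
theorem exists_wires (m n : ℕ) : ∃ e : Register m n ≃ Wire m n (4 * n * 2 ^ m),
    (∀ j, e (index j) = .inl j) ∧ (∀ l, e (word l) = .inr (.inl l)) := by
  have hcard : Fintype.card ((Lane n × Fin (2 ^ m)) ⊕ (Lane n × Fin (2 ^ m))) =
      4 * n * 2 ^ m := by
    simp only [Fintype.card_sum, Fintype.card_prod, Fintype.card_fin]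
    ring
  exact ⟨Equiv.sumCongr (Equiv.refl _) (Equiv.sumCongr (Equiv.refl _)
    (Fintype.equivFinOfCardEq hcard)), fun _ => rfl, fun _ => rfl⟩

/-- The support condition on `ψ` enters here: it leaves only labels of some `k < d`, on which the
circuit is known. -/
theorem withAncillas_eq_sum {n d a : ℕ} (E : Register (Nat.clog 2 d) n ≃ Wire (Nat.clog 2 d) n a)
    (hi : ∀ j, E (index j) = .inl j) (hw : ∀ l, E (word l) = .inr (.inl l))
    (ψ : (Fin (Nat.clog 2 d) → Fin 2) × (Fin n → Fin 2) → ℂ)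
    (hψ : ∀ x z, ψ (x, z) ≠ 0 → ∃ k : Fin d, x = indexBits k) :
    withAncillas a ψ = ∑ k : Fin d, ∑ z, ψ (indexBits k, z) •
      productState E fun q => ket (config k z 0 0 q) := by
  funext x
  have hcond : ∀ (k : Fin d) (z : Fin n → Fin 2), (∀ q, x (E q) = config k z 0 0 q) ↔
      (∀ j : Fin a, x (.inr (.inr j)) = 0) ∧ (indexBits k = fun i => x (.inl i)) ∧
        z = fun l => x (.inr (.inl l)) := by
    intro k z
    constructor
    · refine fun h => ⟨fun j => ?_, ?_, ?_⟩
      · obtain ⟨q, hq⟩ := E.surjective (.inr (.inr j))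
        rw [← hq, h]
        rcases q with q | q | q | q
        · simp [hi] at hq
        · simp [hw] at hq
        · rfl
        · rfl
      · funext j
        rw [← hi, h]
        rfl
      · funext l
        rw [← hw, h]
        rfl
    · rintro ⟨h1, h2, h3⟩ (q | q | q)
      · rw [hi]
        exact (congrFun h2 q).symm
      · rw [hw]
        exact (congrFun h3 q).symm
      · have : config (n := n) (m := Nat.clog 2 d) k z 0 0 (.inr (.inr q)) = 0 := by
          rcases q with q | q <;> rfl
        rw [this]
        rcases hq : E (.inr (.inr q)) with j | l | j
        · rw [← hi] at hq
          simp at hq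
        · rw [← hw] at hq
          simp at hq
        · exact h1 j
  simp only [withAncillas, Finset.sum_apply, Pi.smul_apply, smul_eq_mul, productState_ket, hcond]
  by_cases h : ∀ j : Fin a, x (.inr (.inr j)) = 0
  · by_cases hk : ∃ k : Fin d, indexBits k = fun i => x (.inl i)
    · obtain ⟨k, hk⟩ := hk
      rw [if_pos h, Finset.sum_eq_single k, Finset.sum_eq_single fun l => x (.inr (.inl l))]
      · simp [h, hk]
      · intro z _ hz
        simp [hz]
      · simp
      · intro k' _ hk'
        have : indexBits k' ≠ fun i => x (.inl i) := fun h =>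
          hk' (indexBits_injective (h.trans hk.symm))
        simp [this]
      · simp
    · have h0 : ψ (fun i => x (.inl i), fun l => x (.inr (.inl l))) = 0 := by
        by_contra h0
        obtain ⟨k, hk'⟩ := hψ _ _ h0
        exact hk ⟨k, hk'.symm⟩
      push Not at hk
      simp [h0, hk]
  · simp [h]

theorem exists_realizesSelect {n d : ℕ} (hn : 0 < n) (U : ProductUnitaryFunction n d) :
    ∃ C : Circuit (Wire (Nat.clog 2 d) n (4 * n * 2 ^ Nat.clog 2 d)), RealizesSelect U C ∧
      C.depth ≤ 2 * (5 + Nat.clog 2 n + 5 * Nat.clog 2 d) + 1 := by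
  obtain ⟨E, hi, hw⟩ := exists_wires (Nat.clog 2 d) n
  obtain ⟨C, hC, hrun⟩ := exists_circuit_basis hn (Nat.le_pow_clog (by norm_num) d) E U
  obtain ⟨A, hA⟩ := C.exists_linearMap
  refine ⟨C, fun ψ hψ => ?_, hC⟩
  rw [withAncillas_eq_sum E hi hw ψ hψ, withAncillas_eq_sum E hi hw]
  · simp only [hA, map_sum, map_smul]
    refine Finset.sum_congr rfl fun k _ => ?_
    simp only [← hA, hrun, Finset.smul_sum, smul_smul]
    rw [Finset.sum_comm]
    refine Finset.sum_congr rfl fun z' _ => ?_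
    rw [← Finset.sum_smul, select_mulVec_apply]
    congr 1
    simp only [indexBits_injective.eq_iff, Finset.sum_ite_eq', Finset.mem_univ, if_true]
    exact Finset.sum_congr rfl fun z _ => mul_comm _ _
  -- The expansion is also used for the output, so `select U` must preserve the support condition.
  · intro x z h
    rw [select_mulVec_apply] at h
    obtain ⟨k, _, hk⟩ := Finset.exists_ne_zero_of_sum_ne_zero h
    exact ⟨k, by_contra fun hx => hk (if_neg (Ne.symm hx))⟩

/-! ### Numerical bounds for depth and ancillas -/

theorem clog_two_le_log_succ (n : ℕ) : Nat.clog 2 n ≤ Nat.log 2 n + 1 :=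
  Nat.clog_le_of_le_pow (Nat.lt_pow_succ_log_self (by norm_num) n).le

theorem log_two_add_log_two_le {n d : ℕ} (hn : n ≠ 0) (hd : d ≠ 0) :
    ((Nat.log 2 n + Nat.log 2 d : ℕ) : ℝ) * Real.log 2 ≤ Real.log ((n : ℝ) * d) := by
  rw [← Real.log_pow]
  refine Real.log_le_log (by positivity) ?_
  rw [pow_add]
  exact_mod_cast Nat.mul_le_mul (Nat.pow_log_le_self 2 hn) (Nat.pow_log_le_self 2 hd)

end PUM

end

theorem lemma1 :
    ∃ c : ℝ, ∀ n d : ℕ, 2 ≤ n * d → ∀ U : PUM.ProductUnitaryFunction n d,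
      ∃ (a : ℕ) (C : PUM.Circuit (PUM.Wire (Nat.clog 2 d) n a)),
        PUM.RealizesSelect U C ∧
        (C.depth : ℝ) ≤ c * Real.log ((n : ℝ) * (d : ℝ)) ∧
        (a : ℝ) ≤ c * ((n : ℝ) * (d : ℝ)) := by
  -- The depth is at most `23 + 10 * (Nat.log 2 n + Nat.log 2 d)`. As `n * d ≥ 2`, this is at most
  -- `33 / Real.log 2 < 48` times `Real.log (n * d)`. The ancilla count only needs the constant 8.
  refine ⟨48, fun n d hnd U => ?_⟩
  have hn : n ≠ 0 := by rintro rfl; simp at hnd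
  have hd : d ≠ 0 := by rintro rfl; simp at hnd
  obtain ⟨C, hC, hdepth⟩ := PUM.exists_realizesSelect (Nat.pos_of_ne_zero hn) U
  refine ⟨_, C, hC, ?_, ?_⟩
  · have h2 : C.depth ≤ 23 + 10 * (Nat.log 2 n + Nat.log 2 d) := by
      have := PUM.clog_two_le_log_succ n
      have := PUM.clog_two_le_log_succ d
      omega
    have h3 : (C.depth : ℝ) ≤ 23 + 10 * ((Nat.log 2 n + Nat.log 2 d : ℕ) : ℝ) := by
      exact_mod_cast h2
    have h4 := PUM.log_two_add_log_two_le hn hd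
    have h5 : Real.log 2 ≤ Real.log ((n : ℝ) * d) :=
      Real.log_le_log (by norm_num) (by exact_mod_cast hnd)
    have h6 := Real.log_two_gt_d9
    have h7 : (0 : ℝ) ≤ ((Nat.log 2 n + Nat.log 2 d : ℕ) : ℝ) := by positivity
    nlinarith
  · have h1 : 2 ^ Nat.clog 2 d ≤ 2 * d :=
      calc 2 ^ Nat.clog 2 d ≤ 2 ^ (Nat.log 2 d + 1) :=
            Nat.pow_le_pow_right (by norm_num) (PUM.clog_two_le_log_succ d)
        _ ≤ 2 * d := by
            rw [pow_succ, mul_comm]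
            exact Nat.mul_le_mul_left 2 (Nat.pow_log_le_self 2 hd)
    have h2 : 4 * n * 2 ^ Nat.clog 2 d ≤ 48 * (n * d) := by
      nlinarith [Nat.mul_le_mul_left (4 * n) h1, Nat.zero_le (n * d)]
    exact_mod_cast h2
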